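/- Let $n \ge 1$, let $\alpha \in [0, \pi/2)$, and let $S_\alpha = \{z \in \mathbb{C} : \Re z > 0,\ |\Im z| \le \tan(\alpha)\,\Re z\}$. For a complex $n \times n$ matrix $X$ let $W(X) = \{x^*Xx : x \in \mathbb{C}^n,\ x^*x = 1\}$ be its numerical range and let $s_1(X) \ge s_2(X) \ge \cdots \ge s_n(X)$ be its singular values in decreasing order, counted with multiplicity; $I_n$ denotes the identity matrix. Let $A, B$ be complex $n \times n$ matrices with $W(A) \subset S_\alpha$ and $W(B) \subset S_\alpha$. Then $A$, $B$ and $A+B$ are invertible and, for every $k = 1, \dots, n$, $$\prod_{j=1}^k s_j\big((A+B)^{-1}\big) \le \frac{\sec^{4k}(\alpha)}{4^k} \prod_{j=1}^k s_j(I_n + A^{-1}) \prod_{j=1}^k s_j(I_n + B^{-1}),$$ $$\prod_{j=1}^k s_j\big(I_n + (A+B)^{-1}\big) \le \sec^{2k}(\alpha) \prod_{j=1}^k s_j\Big(I_n + \frac{\sec^2(\alpha)}{4} A^{-1}\Big) \prod_{j=1}^k s_j\Big(I_n + \frac{\sec^2(\alpha)}{4} B^{-1}\Big).$$ -/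

import Mathlib

open scoped Matrix

/-- The sector `S_α = {z ∈ ℂ : Re z > 0, |Im z| ≤ tan α · Re z}`. -/
def sector (α : ℝ) : Set ℂ :=
  {z | 0 < z.re ∧ |z.im| ≤ Real.tan α * z.re}

/-- The numerical range `W(A) = {x* A x : x ∈ ℂⁿ, x* x = 1}`. -/
def matrixNumericalRange {n : ℕ} (A : Matrix (Fin n) (Fin n) ℂ) : Set ℂ :=
  {z | ∃ x : Fin n → ℂ, star x ⬝ᵥ x = 1 ∧ z = star x ⬝ᵥ (A *ᵥ x)}

/-- The singular values of a complex matrix, in decreasing order and with multiplicity, indexed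
from zero: `matrixSingularValue X j` is the `(j + 1)`-st largest singular value of `X`. -/
noncomputable def matrixSingularValue {n : ℕ} (X : Matrix (Fin n) (Fin n) ℂ) (j : ℕ) : ℝ :=
  (Matrix.toEuclideanLin X).singularValues j

/-! Put `t = tan α` and `s = √(1 + t ^ 2) = sec α`. A sectorial `X` factors as `C Z C` with `C² = Re
X` and `Z = 1 + iK`, where `K` is symmetric and `‖K‖ ≤ t`; hence `‖Z‖ ≤ s`, and Horn's inequality
bounds the product of the first `k` singular values of `X` by `s ^ k` times the square of that of
`C` (`IsSectorial.exists_prod_singularValues_le`).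

Cauchy–Schwarz for sectorial forms gives `Re (A+B)⁻¹ ≤ (s²/4) (Re A⁻¹ + Re B⁻¹)`
(`re_inner_inverse_add_le`).

Finally, if `T*T ≤ 1 + Re P + Re Q` with `Re P, Re Q ≥ 0`, write `T = G R` with `R² = 1 + Re P`.
Then `s_j(R)² ≤ s_j(1+P)` and `s_j(G)² ≤ s_j(1+Q)`, and Horn's inequality separates `P` from `Q`
(`prod_singularValues_sq_le`). Together these give powers `3k` and `k` of `sec α`, sharper than
claimed. -/

open Module InnerProductSpace

/-! ### Max-min principle and Horn's inequality for singular values. -/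

namespace LinearMap

section SingularValues

variable {𝕜 : Type*} [RCLike 𝕜]
  {E : Type*} [NormedAddCommGroup E] [InnerProductSpace 𝕜 E] [FiniteDimensional 𝕜 E]
  {F : Type*} [NormedAddCommGroup F] [InnerProductSpace 𝕜 F] [FiniteDimensional 𝕜 F]
  {E' : Type*} [NormedAddCommGroup E'] [InnerProductSpace 𝕜 E'] [FiniteDimensional 𝕜 E']
  {F' : Type*} [NormedAddCommGroup F'] [InnerProductSpace 𝕜 F'] [FiniteDimensional 𝕜 F']

/-- The right singular basis of a linear map diagonalizes `x ↦ ‖T x‖ ^ 2`. -/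
theorem norm_sq_apply_eq_sum_singularValues (T : E →ₗ[𝕜] F) (x : E) :
    ‖T x‖ ^ 2 = ∑ i : Fin (finrank 𝕜 E), T.singularValues i ^ 2 *
      ‖(T.isSymmetric_adjoint_comp_self.eigenvectorBasis rfl).repr x i‖ ^ 2 := by
  set b := T.isSymmetric_adjoint_comp_self.eigenvectorBasis rfl with hb
  have h1 : ((‖T x‖ ^ 2 : ℝ) : 𝕜) = inner 𝕜 x ((adjoint T ∘ₗ T) x) := by
    rw [comp_apply, adjoint_inner_right, inner_self_eq_norm_sq_to_K]
    push_cast; rfl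
  rw [← b.repr.inner_map_map, PiLp.inner_apply] at h1
  have h2 : ∀ i, inner 𝕜 (b.repr x i) (b.repr ((adjoint T ∘ₗ T) x) i) =
      ((T.singularValues i ^ 2 * ‖b.repr x i‖ ^ 2 : ℝ) : 𝕜) := by
    intro i
    rw [hb, IsSymmetric.eigenvectorBasis_apply_self_apply, sq_singularValues_fin T rfl i, ← hb]
    rw [RCLike.inner_apply, mul_assoc, RCLike.mul_conj]
    push_cast; rfl
  simp_rw [h2] at h1
  exact_mod_cast h1

/-- One half of Courant–Fischer: `W` meets the orthogonal complement of the first `j` right singular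
vectors, where `T` stretches by at most the singular value of index `j`. -/
theorem le_singularValues_of_forall_le_norm (T : E →ₗ[𝕜] F) {W : Submodule 𝕜 E} {j : ℕ} {c : ℝ}
    (hj : j < finrank 𝕜 W) (h : ∀ x ∈ W, c * ‖x‖ ≤ ‖T x‖) : c ≤ T.singularValues j := by
  set b := T.isSymmetric_adjoint_comp_self.eigenvectorBasis rfl with hb
  have hjE : j < finrank 𝕜 E := hj.trans_le W.finrank_le
  -- Indices start at zero, so `j` linear conditions on a space of dimension greater than `j` leave
  -- a nonzero `w`.
  let φ : W →ₗ[𝕜] (Fin j → 𝕜) :=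
    LinearMap.pi fun i => (EuclideanSpace.proj (𝕜 := 𝕜) (Fin.castLE hjE.le i)).toLinearMap ∘ₗ
      b.repr.toLinearEquiv.toLinearMap ∘ₗ W.subtype
  obtain ⟨w, hw, hw0⟩ := Submodule.exists_mem_ne_zero_of_ne_bot
    (φ.ker_ne_bot_of_finrank_lt (by simpa using hj))
  have hz : ∀ i : Fin (finrank 𝕜 E), (i : ℕ) < j → b.repr (w : E) i = 0 := by
    intro i hi
    exact congrFun (LinearMap.mem_ker.mp hw) ⟨i, hi⟩
  have hwn : 0 < ‖(w : E)‖ := by simpa using hw0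
  have h1 : ‖T w‖ ^ 2 ≤ (T.singularValues j * ‖(w : E)‖) ^ 2 := by
    rw [norm_sq_apply_eq_sum_singularValues, mul_pow, ← b.repr.norm_map, EuclideanSpace.norm_sq_eq,
      Finset.mul_sum]
    refine Finset.sum_le_sum fun i _ => ?_
    rcases lt_or_ge (i : ℕ) j with hi | hi
    · rw [← hb, hz i hi]; simp
    · gcongr
      · exact T.singularValues_nonneg _
      · exact T.singularValues_antitone hi
  have h2 := le_of_sq_le_sq h1 (mul_nonneg (T.singularValues_nonneg _) (norm_nonneg _))
  exact le_of_mul_le_mul_right ((h w w.2).trans h2) hwn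

/-- The span of the first `k` right singular vectors. -/
noncomputable def leadingSingularSpace (T : E →ₗ[𝕜] F) (k : ℕ) : Submodule 𝕜 E :=
  Submodule.span 𝕜 (Set.range fun i : {i : Fin (finrank 𝕜 E) // (i : ℕ) < k} =>
    T.isSymmetric_adjoint_comp_self.eigenvectorBasis rfl i)

theorem leadingSingularSpace_mono (T : E →ₗ[𝕜] F) : Monotone T.leadingSingularSpace := by
  intro k l hkl
  refine Submodule.span_mono ?_
  rintro _ ⟨i, rfl⟩
  exact ⟨⟨i, i.2.trans_le hkl⟩, rfl⟩

theorem finrank_leadingSingularSpace (T : E →ₗ[𝕜] F) {k : ℕ} (hk : k ≤ finrank 𝕜 E) :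
    finrank 𝕜 (T.leadingSingularSpace k) = k := by
  rw [leadingSingularSpace, finrank_span_eq_card]
  · rw [Fintype.card_subtype]
    calc _ = (Finset.univ.map (Fin.castLEEmb hk)).card := by
          congr 1
          ext i
          simp only [Finset.mem_filter, Finset.mem_univ, true_and, Finset.mem_map]
          exact ⟨fun h => ⟨⟨i, h⟩, rfl⟩, by rintro ⟨a, rfl⟩; exact a.2⟩
      _ = k := by simp
  · exact ((T.isSymmetric_adjoint_comp_self.eigenvectorBasis rfl).orthonormal.comp _
      Subtype.val_injective).linearIndependent

theorem singularValues_mul_norm_le_of_mem (T : E →ₗ[𝕜] F) {j : ℕ} {x : E}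
    (hx : x ∈ T.leadingSingularSpace (j + 1)) : T.singularValues j * ‖x‖ ≤ ‖T x‖ := by
  set b := T.isSymmetric_adjoint_comp_self.eigenvectorBasis rfl with hb
  have hz : ∀ i : Fin (finrank 𝕜 E), j < (i : ℕ) → b.repr x i = 0 := by
    intro i hi
    rw [b.repr_apply_apply]
    have : T.leadingSingularSpace (j + 1) ≤ (innerₛₗ 𝕜 (b i)).ker := by
      refine Submodule.span_le.mpr ?_
      rintro _ ⟨l, rfl⟩
      have hl := l.2
      simpa [← hb] using b.orthonormal.2 (i := i) (j := l) (by rintro rfl; omega)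
    exact LinearMap.mem_ker.mp (this hx)
  refine le_of_sq_le_sq ?_ (norm_nonneg _)
  rw [norm_sq_apply_eq_sum_singularValues, mul_pow, ← b.repr.norm_map, EuclideanSpace.norm_sq_eq,
    Finset.mul_sum]
  refine Finset.sum_le_sum fun i _ => ?_
  rcases lt_or_ge j (i : ℕ) with hi | hi
  · rw [← hb, hz i hi]; simp
  · gcongr
    · exact T.singularValues_nonneg _
    · exact T.singularValues_antitone hi

/-- Comparison principle: a lower bound for `T` at the level of its `j`-th singular value that is
carried by an injective map to a lower bound `c` for `T'` bounds the `j`-th singular value of `T'`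
from below by `c`. -/
theorem le_singularValues_of_comparison (T : E →ₗ[𝕜] F) (T' : E' →ₗ[𝕜] F') (L : E →ₗ[𝕜] E')
    (hL : Function.Injective L) {j : ℕ} (hj : j < finrank 𝕜 E) {c : ℝ}
    (h : ∀ x, T.singularValues j * ‖x‖ ≤ ‖T x‖ → c * ‖L x‖ ≤ ‖T' (L x)‖) :
    c ≤ T'.singularValues j := by
  refine T'.le_singularValues_of_forall_le_norm (W := (T.leadingSingularSpace (j + 1)).map L) ?_ ?_
  · rw [← (Submodule.equivMapOfInjective L hL _).finrank_eq, T.finrank_leadingSingularSpace hj]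
    exact j.lt_succ_self
  · rintro _ ⟨x, hx, rfl⟩
    exact h x (T.singularValues_mul_norm_le_of_mem hx)

theorem singularValues_domRestrict_le (T : E →ₗ[𝕜] F) (W : Submodule 𝕜 E) {j : ℕ}
    (hj : j < finrank 𝕜 W) : (T.domRestrict W).singularValues j ≤ T.singularValues j :=
  le_singularValues_of_comparison (T.domRestrict W) T W.subtype W.injective_subtype hj
    fun _ h => h

theorem singularValues_le_mul_singularValues (T : E →ₗ[𝕜] F) (T' : E →ₗ[𝕜] F') {m : ℝ}
    (hm : 0 < m) (h : ∀ x, ‖T x‖ ≤ m * ‖T' x‖) {j : ℕ} (hj : j < finrank 𝕜 E) :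
    T.singularValues j ≤ m * T'.singularValues j := by
  rw [← div_le_iff₀' hm]
  refine le_singularValues_of_comparison T T' LinearMap.id Function.injective_id hj fun x hx => ?_
  rw [id_apply, div_mul_eq_mul_div, div_le_iff₀' hm]
  exact hx.trans (h x)

theorem normDet_domRestrict_le (T : E →ₗ[𝕜] F) (W : Submodule 𝕜 E) :
    (T.domRestrict W).normDet ≤ ∏ j ∈ Finset.range (finrank 𝕜 W), T.singularValues j := by
  rw [normDet_eq_prod_singularValues]
  exact Finset.prod_le_prod (fun _ _ => singularValues_nonneg _ _)
    fun j hj => T.singularValues_domRestrict_le W (Finset.mem_range.mp hj)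

/-- With `normDet_domRestrict_le`, this makes the product of the first `k` singular values the
largest `k`-dimensional volume distortion of `T`. -/
theorem prod_singularValues_le_normDet (T : E →ₗ[𝕜] F) {k : ℕ} (hk : k ≤ finrank 𝕜 E) :
    ∏ j ∈ Finset.range k, T.singularValues j ≤
      (T.domRestrict (T.leadingSingularSpace k)).normDet := by
  rw [normDet_eq_prod_singularValues, T.finrank_leadingSingularSpace hk]
  refine Finset.prod_le_prod (fun _ _ => singularValues_nonneg _ _) fun j hj => ?_
  have hj := Finset.mem_range.mp hj
  refine le_singularValues_of_forall_le_norm _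
    (W := (T.leadingSingularSpace (j + 1)).submoduleOf (T.leadingSingularSpace k)) ?_ ?_
  · rw [(Submodule.submoduleOfEquivOfLe (T.leadingSingularSpace_mono hj)).finrank_eq,
      T.finrank_leadingSingularSpace (hj.trans_le hk)]
    exact j.lt_succ_self
  · intro x hx
    exact T.singularValues_mul_norm_le_of_mem (x := x) hx

/-- Horn's inequality for the singular values of a composition. -/
theorem prod_singularValues_comp_le (S : F →ₗ[𝕜] F') (T : E →ₗ[𝕜] F) {k : ℕ}
    (hk : k ≤ finrank 𝕜 E) :
    ∏ j ∈ Finset.range k, (S ∘ₗ T).singularValues j ≤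
      (∏ j ∈ Finset.range k, S.singularValues j) * ∏ j ∈ Finset.range k, T.singularValues j := by
  set W := (S ∘ₗ T).leadingSingularSpace k
  have hW : finrank 𝕜 W = k := finrank_leadingSingularSpace _ hk
  have hprod : 0 ≤ (∏ j ∈ Finset.range k, S.singularValues j) *
      ∏ j ∈ Finset.range k, T.singularValues j :=
    mul_nonneg (Finset.prod_nonneg fun _ _ => singularValues_nonneg _ _)
      (Finset.prod_nonneg fun _ _ => singularValues_nonneg _ _)
  refine (prod_singularValues_le_normDet _ hk).trans ?_
  have hcomp : (S ∘ₗ T).domRestrict W = S ∘ₗ T.domRestrict W := rfl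
  rw [hcomp, normDet_comp]
  -- When the volume factor of `T` on `W` is nonzero, `T` is injective there, so `S` is restricted
  -- to a space of dimension exactly `k`.
  by_cases h0 : (T.domRestrict W).normDet = 0
  · rwa [h0, mul_zero]
  have hr : finrank 𝕜 (T.domRestrict W).range = k := by
    rw [← hW]
    exact not_not.mp (mt normDet_eq_zero_iff_rank_range_ne.mpr h0)
  refine mul_le_mul ?_ ?_ (normDet_nonneg _)
    (Finset.prod_nonneg fun _ _ => singularValues_nonneg _ _)
  · exact (S.normDet_domRestrict_le _).trans_eq (by rw [hr])
  · exact (T.normDet_domRestrict_le W).trans_eq (by rw [hW])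

end SingularValues

end LinearMap
-- Sectorial operators: closure properties.
namespace LinearMap

section Sectorial

variable {E : Type*} [NormedAddCommGroup E] [InnerProductSpace ℂ E]

/-- An operator whose quadratic form takes values, away from zero, in the sector of the right
half-plane of slope `t`. -/
def IsSectorial (t : ℝ) (X : E →ₗ[ℂ] E) : Prop :=
  ∀ x ≠ 0, 0 < (inner ℂ x (X x)).re ∧ |(inner ℂ x (X x)).im| ≤ t * (inner ℂ x (X x)).re

namespace IsSectorial

variable {t : ℝ} {X Y : E →ₗ[ℂ] E}

theorem re_nonneg (hX : IsSectorial t X) (x : E) : 0 ≤ (inner ℂ x (X x)).re := by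
  rcases eq_or_ne x 0 with rfl | hx
  · simp
  · exact (hX x hx).1.le

theorem add (hX : IsSectorial t X) (hY : IsSectorial t Y) : IsSectorial t (X + Y) := by
  intro x hx
  obtain ⟨h1, h2⟩ := hX x hx
  obtain ⟨h3, h4⟩ := hY x hx
  rw [add_apply, inner_add_right, Complex.add_re, Complex.add_im, mul_add]
  exact ⟨add_pos h1 h3, (abs_add_le _ _).trans (add_le_add h2 h4)⟩

theorem one (ht : 0 ≤ t) : IsSectorial t (1 : E →ₗ[ℂ] E) := by
  intro x hx
  have h : inner ℂ x ((1 : E →ₗ[ℂ] E) x) = ((‖x‖ ^ 2 : ℝ) : ℂ) := by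
    rw [Module.End.one_apply, inner_self_eq_norm_sq_to_K]; push_cast; rfl
  have hx' : 0 < ‖x‖ := norm_pos_iff.mpr hx
  rw [h, Complex.ofReal_re, Complex.ofReal_im, abs_zero]
  exact ⟨by positivity, by positivity⟩

theorem smul (hX : IsSectorial t X) {c : ℝ} (hc : 0 < c) : IsSectorial t ((c : ℂ) • X) := by
  intro x hx
  obtain ⟨h1, h2⟩ := hX x hx
  rw [smul_apply, inner_smul_right, Complex.re_ofReal_mul, Complex.im_ofReal_mul, abs_mul,
    abs_of_pos hc, mul_left_comm]
  exact ⟨mul_pos hc h1, mul_le_mul_of_nonneg_left h2 hc.le⟩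

theorem injective (hX : IsSectorial t X) : Function.Injective X := by
  rw [injective_iff_map_eq_zero]
  intro x hx
  by_contra h
  simpa [hx] using (hX x h).1

/-- The form of `Y` at `x` is the conjugate of the form of `X` at `Y x`, and the sector is symmetric
under conjugation. -/
theorem of_mul_eq_one (hX : IsSectorial t X) (h : X * Y = 1) : IsSectorial t Y := by
  intro x hx
  have hXY : X (Y x) = x := LinearMap.congr_fun h x
  have hY : Y x ≠ 0 := by
    intro h0
    rw [h0, map_zero] at hXY
    exact hx hXY.symm
  have h2 : inner ℂ x (Y x) = (starRingEnd ℂ) (inner ℂ (Y x) (X (Y x))) := by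
    rw [hXY, inner_conj_symm]
  rw [h2, Complex.conj_re, Complex.conj_im, abs_neg]
  exact hX _ hY

end IsSectorial

/-! ### Factorization, form inequalities and products of singular values. -/

variable [FiniteDimensional ℂ E]

theorem IsPositive.exists_isSymmetric_mul_self {H : E →ₗ[ℂ] E} (hH : H.IsPositive) :
    ∃ C : E →ₗ[ℂ] E, C.IsSymmetric ∧ C * C = H := by
  have : CompleteSpace E := FiniteDimensional.complete ℂ E
  have hnonneg : 0 ≤ toContinuousLinearMap H :=
    (ContinuousLinearMap.nonneg_iff_isPositive _).mpr hH
  obtain ⟨S, hS, hSS⟩ : ∃ S : E →L[ℂ] E, 0 ≤ S ∧ S * S = toContinuousLinearMap H :=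
    ⟨_, CFC.sqrt_nonneg _, CFC.sqrt_mul_sqrt_self _ hnonneg⟩
  exact ⟨S, ((ContinuousLinearMap.nonneg_iff_isPositive _).mp hS).isSymmetric,
    congrArg ContinuousLinearMap.toLinearMap hSS⟩

/-- Square root of the real part of an accretive operator. -/
theorem exists_isSymmetric_norm_sq_eq_re_inner (X : E →ₗ[ℂ] E)
    (hX : ∀ x, 0 ≤ (inner ℂ x (X x)).re) :
    ∃ C : E →ₗ[ℂ] E, C.IsSymmetric ∧ ∀ x, ‖C x‖ ^ 2 = (inner ℂ x (X x)).re := by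
  obtain ⟨H, hH, hsymm⟩ : ∃ H : E →ₗ[ℂ] E, (∀ x, (inner ℂ x (H x)).re = (inner ℂ x (X x)).re) ∧
      H.IsSymmetric := by
    refine ⟨((1 / 2 : ℝ) : ℂ) • (X + adjoint X), fun x => ?_, fun x y => ?_⟩
    · rw [smul_apply, add_apply, inner_smul_right, Complex.re_ofReal_mul, inner_add_right,
        adjoint_inner_right, ← inner_conj_symm (X x) x, Complex.add_re, Complex.conj_re]
      ring
    · simp only [smul_apply, add_apply, inner_smul_left, inner_smul_right, inner_add_left,
        inner_add_right, adjoint_inner_left, adjoint_inner_right, Complex.conj_ofReal]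
      ring
  have hpos : H.IsPositive := by
    refine ⟨hsymm, fun x => ?_⟩
    rw [hsymm x x]
    exact (hX x).trans_eq (hH x).symm
  obtain ⟨C, hC, hCC⟩ := hpos.exists_isSymmetric_mul_self
  refine ⟨C, hC, fun x => ?_⟩
  rw [← hH x, ← hCC, Module.End.mul_apply, ← hC x (C x)]
  exact (inner_self_eq_norm_sq (𝕜 := ℂ) (C x)).symm

/-- A symmetric operator is bounded by its numerical radius. -/
theorem IsSymmetric.norm_apply_le {K : E →ₗ[ℂ] E} (hK : K.IsSymmetric) {t : ℝ} (ht : 0 ≤ t)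
    (h : ∀ x, |(inner ℂ (K x) x).re| ≤ t * ‖x‖ ^ 2) (x : E) : ‖K x‖ ≤ t * ‖x‖ := by
  refine (toContinuousLinearMap K).le_of_opNorm_le ?_ x
  rw [ContinuousLinearMap.norm_eq_iSup_rayleighQuotient _ hK]
  refine ciSup_le fun y => ?_
  rw [ContinuousLinearMap.rayleighQuotient, abs_div, abs_sq]
  exact div_le_of_le_mul₀ (sq_nonneg _) ht (h y)

/-- An operator with real part `1` and imaginary part of numerical radius at most `t` has norm at
most `√(1 + t ^ 2)`. -/
theorem norm_sq_apply_le_of_re_inner_eq {Z : E →ₗ[ℂ] E} {t : ℝ} (ht : 0 ≤ t)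
    (hre : ∀ x, (inner ℂ x (Z x)).re = ‖x‖ ^ 2) (him : ∀ x, |(inner ℂ x (Z x)).im| ≤ t * ‖x‖ ^ 2)
    (x : E) : ‖Z x‖ ^ 2 ≤ (1 + t ^ 2) * ‖x‖ ^ 2 := by
  set K : E →ₗ[ℂ] E := (-Complex.I) • (Z - 1) with hKdef
  have hKx : ∀ x, inner ℂ x (K x) = ((inner ℂ x (Z x)).im : ℂ) := by
    intro x
    have h1 : inner ℂ x (Z x) = ((‖x‖ ^ 2 : ℝ) : ℂ) + (inner ℂ x (Z x)).im * Complex.I := by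
      conv_lhs => rw [← Complex.re_add_im (inner ℂ x (Z x)), hre]
    rw [hKdef, smul_apply, sub_apply, Module.End.one_apply, inner_smul_right, inner_sub_right,
      inner_self_eq_norm_sq_to_K]
    conv_lhs => rw [h1]
    push_cast
    linear_combination (-((inner ℂ x (Z x)).im : ℂ)) * Complex.I_mul_I
  have hK : K.IsSymmetric := by
    rw [isSymmetric_iff_inner_map_self_real]
    intro v
    rw [← inner_conj_symm, hKx, Complex.conj_ofReal, Complex.conj_ofReal]
  have hKn : ‖K x‖ ≤ t * ‖x‖ := by
    refine hK.norm_apply_le ht (fun y => ?_) x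
    rw [hK y y, hKx, Complex.ofReal_re]
    exact him y
  have hZ : Z x = x + Complex.I • K x := by
    rw [hKdef, smul_apply, smul_smul, sub_apply, Module.End.one_apply]
    simp
  -- The cross term vanishes because `⟨x, K x⟩` is real.
  have h3 : ‖Z x‖ ^ 2 = ‖x‖ ^ 2 + ‖K x‖ ^ 2 := by
    have h4 := norm_add_sq (𝕜 := ℂ) x (Complex.I • K x)
    rw [← hZ, inner_smul_right, hKx, norm_smul, Complex.norm_I, one_mul] at h4
    simpa using h4
  rw [h3]
  nlinarith [pow_le_pow_left₀ (norm_nonneg _) hKn 2]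

/-- Symmetric factorization of a sectorial operator. -/
theorem IsSectorial.exists_factorization {t : ℝ} (ht : 0 ≤ t) {X : E →ₗ[ℂ] E}
    (hX : IsSectorial t X) :
    ∃ C Z : E →ₗ[ℂ] E, C.IsSymmetric ∧ X = C ∘ₗ Z ∘ₗ C ∧
      (∀ x, ‖C x‖ ^ 2 = (inner ℂ x (X x)).re) ∧ ∀ x, ‖Z x‖ ≤ √(1 + t ^ 2) * ‖x‖ := by
  obtain ⟨C, hC, hCX⟩ := exists_isSymmetric_norm_sq_eq_re_inner X hX.re_nonneg
  have hinj : Function.Injective C := by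
    rw [injective_iff_map_eq_zero]
    intro x hx
    by_contra h
    have := (hX x h).1
    rw [← hCX, hx] at this
    simp at this
  let e : E ≃ₗ[ℂ] E := LinearEquiv.ofInjectiveEndo C hinj
  have he : ∀ x, C (e.symm x) = x := e.apply_symm_apply
  have he' : ∀ x, e.symm (C x) = x := e.symm_apply_apply
  have hZ : ∀ x, inner ℂ x (e.symm (X (e.symm x))) = inner ℂ (e.symm x) (X (e.symm x)) := by
    intro x
    conv_lhs => rw [← he x, hC, he, he]
  refine ⟨C, e.symm.toLinearMap ∘ₗ X ∘ₗ e.symm.toLinearMap, hC, ?_, hCX, fun x => ?_⟩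
  · ext x
    simp [he, he']
  · have h := norm_sq_apply_le_of_re_inner_eq (Z := e.symm.toLinearMap ∘ₗ X ∘ₗ e.symm.toLinearMap)
      ht (fun x => ?_) (fun x => ?_) x
    · refine le_of_sq_le_sq ?_ (by positivity)
      rwa [mul_pow, Real.sq_sqrt (by positivity)]
    · change (inner ℂ x (e.symm (X (e.symm x)))).re = _
      rw [hZ, ← hCX, he]
    · change |(inner ℂ x (e.symm (X (e.symm x)))).im| ≤ _
      have h2 : |(inner ℂ (e.symm x) (X (e.symm x))).im| ≤
          t * (inner ℂ (e.symm x) (X (e.symm x))).re := by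
        rcases eq_or_ne (e.symm x) 0 with h0 | h0
        · simp [h0]
        · exact (hX _ h0).2
      rwa [← hCX, he, ← hZ] at h2

/-- Cauchy–Schwarz inequality for a sectorial form. -/
theorem IsSectorial.norm_inner_sq_le {t : ℝ} (ht : 0 ≤ t) {X : E →ₗ[ℂ] E} (hX : IsSectorial t X)
    (x y : E) : ‖inner ℂ y (X x)‖ ^ 2 ≤
      (1 + t ^ 2) * (inner ℂ y (X y)).re * (inner ℂ x (X x)).re := by
  obtain ⟨C, Z, hC, hXC, hCX, hZ⟩ := hX.exists_factorization ht
  rw [← hCX, ← hCX, ← Real.sq_sqrt (show 0 ≤ 1 + t ^ 2 by positivity), ← mul_pow, ← mul_pow]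
  refine pow_le_pow_left₀ (norm_nonneg _) ?_ 2
  have h : inner ℂ y (X x) = inner ℂ (C y) (Z (C x)) := by
    rw [hC]
    exact congrArg (inner ℂ y) (LinearMap.congr_fun hXC x)
  rw [h]
  calc ‖inner ℂ (C y) (Z (C x))‖ ≤ ‖C y‖ * ‖Z (C x)‖ := norm_inner_le_norm _ _
    _ ≤ ‖C y‖ * (√(1 + t ^ 2) * ‖C x‖) := by gcongr; exact hZ _
    _ = _ := by ring

/-- The real part of the inverse of a sum of sectorial operators is controlled by a quarter of the
sum of the real parts of the inverses. -/
theorem re_inner_inverse_add_le {t : ℝ} (ht : 0 ≤ t) {A B A' B' D : E →ₗ[ℂ] E}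
    (hA : IsSectorial t A) (hB : IsSectorial t B) (hAA' : A * A' = 1) (hBB' : B * B' = 1)
    (hD : (A + B) * D = 1) (x : E) :
    (inner ℂ x (D x)).re ≤
      (1 + t ^ 2) / 4 * ((inner ℂ x (A' x)).re + (inner ℂ x (B' x)).re) := by
  rcases eq_or_ne x 0 with rfl | hx
  · simp
  have key : ∀ {M M' : E →ₗ[ℂ] E}, IsSectorial t M → M * M' = 1 →
      (inner ℂ x (D x)).re ^ 2 ≤
        (1 + t ^ 2) * (inner ℂ (D x) (M (D x))).re * (inner ℂ x (M' x)).re := by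
    intro M M' hM hMM'
    have hMx : M (M' x) = x := LinearMap.congr_fun hMM' x
    have h := hM.norm_inner_sq_le ht (M' x) (D x)
    rw [hMx] at h
    have h2 : (inner ℂ (M' x) x).re = (inner ℂ x (M' x)).re := by
      rw [← inner_conj_symm, Complex.conj_re]
    rw [h2] at h
    refine le_trans ?_ h
    rw [← inner_conj_symm, Complex.conj_re, ← sq_abs]
    exact pow_le_pow_left₀ (abs_nonneg _) (Complex.abs_re_le_norm _) 2
  have hDx : (A + B) (D x) = x := LinearMap.congr_fun hD x
  have hsum : (inner ℂ x (D x)).re =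
      (inner ℂ (D x) (A (D x))).re + (inner ℂ (D x) (B (D x))).re := by
    rw [← Complex.add_re, ← inner_add_right, ← add_apply, hDx, ← inner_conj_symm, Complex.conj_re]
  have hD0 : D x ≠ 0 := by
    intro h0
    rw [h0, map_zero] at hDx
    exact hx hDx.symm
  have h1 := key hA hAA'
  have h2 := key hB hBB'
  have hp := (hA _ hD0).1
  have hq := (hB _ hD0).1
  rw [hsum] at h1 h2 ⊢
  set p := (inner ℂ (D x) (A (D x))).re
  set q := (inner ℂ (D x) (B (D x))).re
  set a := (inner ℂ x (A' x)).re
  set b := (inner ℂ x (B' x)).re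
  have h3 : (p + q) ^ 2 / p ≤ (1 + t ^ 2) * a := by
    rw [div_le_iff₀ hp]; linarith
  have h4 : (p + q) ^ 2 / q ≤ (1 + t ^ 2) * b := by
    rw [div_le_iff₀ hq]; linarith
  -- This is `1/p + 1/q ≥ 4/(p + q)`, the source of the factor `1/4`.
  have h5 : 4 * (p + q) ≤ (p + q) ^ 2 / p + (p + q) ^ 2 / q := by
    rw [div_add_div _ _ hp.ne' hq.ne', le_div_iff₀ (mul_pos hp hq)]
    nlinarith [mul_nonneg (add_pos hp hq).le (sq_nonneg (p - q))]
  linarith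

/-- Product bound for the singular values of a sectorial operator by those of its real part. -/
theorem IsSectorial.exists_prod_singularValues_le {t : ℝ} (ht : 0 ≤ t) {X : E →ₗ[ℂ] E}
    (hX : IsSectorial t X) :
    ∃ C : E →ₗ[ℂ] E, (∀ x, ‖C x‖ ^ 2 = (inner ℂ x (X x)).re) ∧ ∀ k ≤ finrank ℂ E,
      ∏ j ∈ Finset.range k, X.singularValues j ≤
        √(1 + t ^ 2) ^ k * (∏ j ∈ Finset.range k, C.singularValues j) ^ 2 := by
  obtain ⟨C, Z, hC, hXC, hCX, hZ⟩ := hX.exists_factorization ht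
  refine ⟨C, hCX, fun k hk => ?_⟩
  have h0 : 0 ≤ ∏ j ∈ Finset.range k, C.singularValues j :=
    Finset.prod_nonneg fun _ _ => singularValues_nonneg _ _
  have hs : 0 < √(1 + t ^ 2) := by positivity
  calc ∏ j ∈ Finset.range k, X.singularValues j
      ≤ (∏ j ∈ Finset.range k, C.singularValues j) *
        ∏ j ∈ Finset.range k, (Z ∘ₗ C).singularValues j := by
        rw [hXC]; exact prod_singularValues_comp_le _ _ hk
    _ ≤ (∏ j ∈ Finset.range k, C.singularValues j) *
        ∏ j ∈ Finset.range k, (√(1 + t ^ 2) * C.singularValues j) := by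
        refine mul_le_mul_of_nonneg_left (Finset.prod_le_prod
          (fun _ _ => singularValues_nonneg _ _) fun j hj => ?_) h0
        exact singularValues_le_mul_singularValues _ _ hs (fun x => hZ (C x))
          ((Finset.mem_range.mp hj).trans_le hk)
    _ = _ := by
        rw [Finset.prod_mul_distrib, Finset.prod_const, Finset.card_range]; ring

/-- If `‖x‖ ^ 2 + Re ⟨x, P x⟩ + Re ⟨x, Q x⟩` dominates `‖T x‖ ^ 2`, then the products of squared
singular values of `T` are dominated by those of `1 + P` and `1 + Q`. -/
theorem prod_singularValues_sq_le {T P Q : E →ₗ[ℂ] E}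
    (hP : ∀ x, 0 ≤ (inner ℂ x (P x)).re) (hQ : ∀ x, 0 ≤ (inner ℂ x (Q x)).re)
    (hT : ∀ x, ‖T x‖ ^ 2 ≤ ‖x‖ ^ 2 + (inner ℂ x (P x)).re + (inner ℂ x (Q x)).re)
    {k : ℕ} (hk : k ≤ finrank ℂ E) :
    (∏ j ∈ Finset.range k, T.singularValues j) ^ 2 ≤
      (∏ j ∈ Finset.range k, (1 + P).singularValues j) *
        ∏ j ∈ Finset.range k, (1 + Q).singularValues j := by
  have hre : ∀ (M : E →ₗ[ℂ] E) (x : E),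
      (inner ℂ x ((1 + M) x)).re = ‖x‖ ^ 2 + (inner ℂ x (M x)).re := by
    intro M x
    rw [add_apply, Module.End.one_apply, inner_add_right, Complex.add_re]
    congr 1
    exact inner_self_eq_norm_sq (𝕜 := ℂ) x
  have hnorm : ∀ {M : E →ₗ[ℂ] E} {x : E} {c : ℝ},
      c * ‖x‖ ^ 2 ≤ (inner ℂ x (M x)).re → c * ‖x‖ ≤ ‖M x‖ := by
    intro M x c h
    rcases eq_or_ne x 0 with rfl | hx
    · simp
    have hx' : 0 < ‖x‖ := norm_pos_iff.mpr hx
    have h2 : (inner ℂ x (M x)).re ≤ ‖x‖ * ‖M x‖ := re_inner_le_norm (𝕜 := ℂ) x (M x)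
    nlinarith
  obtain ⟨R, -, hR⟩ := exists_isSymmetric_norm_sq_eq_re_inner (1 + P) fun x => by
    rw [hre]; exact add_nonneg (sq_nonneg _) (hP x)
  simp only [hre] at hR
  have hinj : Function.Injective R := by
    rw [injective_iff_map_eq_zero]
    intro x hx
    have h := hR x
    rw [hx, norm_zero] at h
    have h2 : ‖x‖ ^ 2 = 0 := by nlinarith [hP x, sq_nonneg ‖x‖]
    simpa using h2
  let e : E ≃ₗ[ℂ] E := LinearEquiv.ofInjectiveEndo R hinj
  have he : ∀ x, R (e.symm x) = x := e.apply_symm_apply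
  have he' : ∀ x, e.symm (R x) = x := e.symm_apply_apply
  set G : E →ₗ[ℂ] E := T ∘ₗ e.symm.toLinearMap with hG
  have hTG : T = G ∘ₗ R := by
    ext x
    simp [hG, he']
  have hRs : ∀ j < finrank ℂ E, R.singularValues j ^ 2 ≤ (1 + P).singularValues j := by
    intro j hj
    refine le_singularValues_of_comparison R (1 + P) LinearMap.id Function.injective_id hj
      fun x hx => hnorm ?_
    rw [id_apply, hre, ← hR, ← mul_pow]
    exact pow_le_pow_left₀ (mul_nonneg (singularValues_nonneg _ _) (norm_nonneg _)) hx 2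
  have hGs : ∀ j < finrank ℂ E, G.singularValues j ^ 2 ≤ (1 + Q).singularValues j := by
    intro j hj
    refine le_singularValues_of_comparison G (1 + Q) e.symm.toLinearMap e.symm.injective hj
      fun x hx => hnorm ?_
    have h1 := pow_le_pow_left₀ (mul_nonneg (singularValues_nonneg _ _) (norm_nonneg _)) hx 2
    have h2 := hR (e.symm x)
    rw [he] at h2
    have h3 := h1.trans (hT (e.symm x))
    rw [mul_pow, h2] at h3
    change _ * ‖e.symm x‖ ^ 2 ≤ (inner ℂ (e.symm x) ((1 + Q) (e.symm x))).re
    rw [hre]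
    have h4 := hP (e.symm x)
    have h5 := hQ (e.symm x)
    -- With `σ` the singular value and `v = e.symm x`, `h3` reads `σ²(‖v‖² + p) ≤ ‖v‖² + p + q`. If
    -- `σ² ≥ 1`, then `p` cancels; otherwise `q ≥ 0` suffices.
    rcases le_total (G.singularValues j ^ 2) 1 with hs | hs
    · nlinarith [sq_nonneg ‖e.symm x‖]
    · nlinarith
  have hprod : ∀ {M N : E →ₗ[ℂ] E}, (∀ j < finrank ℂ E, M.singularValues j ^ 2 ≤ N.singularValues j)
      → (∏ j ∈ Finset.range k, M.singularValues j) ^ 2 ≤ ∏ j ∈ Finset.range k, N.singularValues j := by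
    intro M N h
    rw [← Finset.prod_pow]
    exact Finset.prod_le_prod (fun _ _ => sq_nonneg _)
      fun j hj => h j ((Finset.mem_range.mp hj).trans_le hk)
  have h0 : ∀ M : E →ₗ[ℂ] E, 0 ≤ ∏ j ∈ Finset.range k, M.singularValues j :=
    fun M => Finset.prod_nonneg fun _ _ => singularValues_nonneg _ _
  calc (∏ j ∈ Finset.range k, T.singularValues j) ^ 2
      ≤ ((∏ j ∈ Finset.range k, G.singularValues j) *
          ∏ j ∈ Finset.range k, R.singularValues j) ^ 2 := by
        refine pow_le_pow_left₀ (h0 T) ?_ 2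
        rw [hTG]
        exact prod_singularValues_comp_le _ _ hk
    _ = (∏ j ∈ Finset.range k, R.singularValues j) ^ 2 *
          (∏ j ∈ Finset.range k, G.singularValues j) ^ 2 := by ring
    _ ≤ _ := mul_le_mul (hprod hRs) (hprod hGs) (sq_nonneg _) (h0 _)

/-! ### The two product inequalities for operators. -/

variable {t : ℝ} {A B A' B' D : E →ₗ[ℂ] E}

theorem prod_singularValues_inverse_add_le (ht : 0 ≤ t) (hA : IsSectorial t A)
    (hB : IsSectorial t B) (hAA' : A * A' = 1) (hBB' : B * B' = 1) (hD : (A + B) * D = 1)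
    {k : ℕ} (hk : k ≤ finrank ℂ E) :
    ∏ j ∈ Finset.range k, D.singularValues j ≤
      √(1 + t ^ 2) ^ (3 * k) / 4 ^ k * (∏ j ∈ Finset.range k, (1 + A').singularValues j) *
        ∏ j ∈ Finset.range k, (1 + B').singularValues j := by
  set s := √(1 + t ^ 2) with hs
  have hs0 : 0 < s := by positivity
  have hs2 : s ^ 2 = 1 + t ^ 2 := Real.sq_sqrt (by positivity)
  have hA's := hA.of_mul_eq_one hAA'
  have hB's := hB.of_mul_eq_one hBB'
  obtain ⟨C, hC, hDC⟩ := ((hA.add hB).of_mul_eq_one hD).exists_prod_singularValues_le ht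
  -- The scaling by `2 / s` absorbs the constant `s²/4` of `re_inner_inverse_add_le`; undoing it
  -- costs `(s²/4) ^ k`, which with the `s ^ k` of the factorization gives `s ^ (3 * k) / 4 ^ k`.
  set T : E →ₗ[ℂ] E := ((2 / s : ℝ) : ℂ) • C with hT
  have hTn : ∀ x, ‖T x‖ = 2 / s * ‖C x‖ := fun x => by
    rw [hT, smul_apply, norm_smul, Complex.norm_real, Real.norm_of_nonneg (by positivity)]
  have h1 := prod_singularValues_sq_le (T := T) hA's.re_nonneg hB's.re_nonneg (fun x => by
    rw [hTn, mul_pow, hC, div_pow, hs2]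
    have h := re_inner_inverse_add_le ht hA hB hAA' hBB' hD x
    rw [div_mul_eq_mul_div, div_le_iff₀ (by positivity)]
    nlinarith [mul_nonneg (sq_nonneg ‖x‖) (show 0 ≤ 1 + t ^ 2 by positivity)]) hk
  have h2 : ∏ j ∈ Finset.range k, C.singularValues j ≤
      (s / 2) ^ k * ∏ j ∈ Finset.range k, T.singularValues j := by
    rw [← Finset.card_range k, ← Finset.prod_const, Finset.card_range, ← Finset.prod_mul_distrib]
    refine Finset.prod_le_prod (fun _ _ => singularValues_nonneg _ _) fun j hj => ?_
    refine singularValues_le_mul_singularValues C T (by positivity) (fun x => ?_)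
      ((Finset.mem_range.mp hj).trans_le hk)
    rw [hTn]
    exact le_of_eq (by field_simp)
  have h3 : 0 ≤ ∏ j ∈ Finset.range k, C.singularValues j :=
    Finset.prod_nonneg fun _ _ => singularValues_nonneg _ _
  calc ∏ j ∈ Finset.range k, D.singularValues j
      ≤ s ^ k * (∏ j ∈ Finset.range k, C.singularValues j) ^ 2 := hDC k hk
    _ ≤ s ^ k * ((s / 2) ^ k * ∏ j ∈ Finset.range k, T.singularValues j) ^ 2 := by gcongr
    _ = s ^ (3 * k) / 4 ^ k * (∏ j ∈ Finset.range k, T.singularValues j) ^ 2 := by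
        have h4 : (4 : ℝ) ^ k = 2 ^ (k * 2) := by rw [pow_mul', show (2 : ℝ) ^ 2 = 4 by norm_num]
        rw [h4, div_pow]
        field_simp
        ring
    _ ≤ s ^ (3 * k) / 4 ^ k * ((∏ j ∈ Finset.range k, (1 + A').singularValues j) *
        ∏ j ∈ Finset.range k, (1 + B').singularValues j) := by gcongr
    _ = _ := by ring

/-- Here `s²/4` stays inside `P` and `Q`, and the identity in `1 + D` uses up the `‖x‖ ^ 2` term, so
only the factorization of `1 + D` costs `s ^ k`. -/
theorem prod_singularValues_one_add_inverse_add_le (ht : 0 ≤ t) (hA : IsSectorial t A)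
    (hB : IsSectorial t B) (hAA' : A * A' = 1) (hBB' : B * B' = 1) (hD : (A + B) * D = 1)
    {k : ℕ} (hk : k ≤ finrank ℂ E) :
    ∏ j ∈ Finset.range k, (1 + D).singularValues j ≤
      √(1 + t ^ 2) ^ k *
        (∏ j ∈ Finset.range k, (1 + (((1 + t ^ 2) / 4 : ℝ) : ℂ) • A').singularValues j) *
        ∏ j ∈ Finset.range k, (1 + (((1 + t ^ 2) / 4 : ℝ) : ℂ) • B').singularValues j := by
  have hc : 0 < (1 + t ^ 2) / 4 := by positivity
  obtain ⟨C, hC, hDC⟩ :=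
    ((IsSectorial.one ht).add ((hA.add hB).of_mul_eq_one hD)).exists_prod_singularValues_le ht
  rw [mul_assoc]
  refine (hDC k hk).trans (mul_le_mul_of_nonneg_left ?_ (by positivity))
  refine prod_singularValues_sq_le ((hA.of_mul_eq_one hAA').smul hc).re_nonneg
    ((hB.of_mul_eq_one hBB').smul hc).re_nonneg (fun x => ?_) hk
  have h : (inner ℂ x ((1 + D) x)).re = ‖x‖ ^ 2 + (inner ℂ x (D x)).re := by
    rw [add_apply, Module.End.one_apply, inner_add_right, Complex.add_re]
    congr 1
    exact inner_self_eq_norm_sq (𝕜 := ℂ) x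
  rw [hC, h, smul_apply, smul_apply, inner_smul_right, inner_smul_right, Complex.re_ofReal_mul,
    Complex.re_ofReal_mul, add_assoc, ← mul_add]
  gcongr
  exact re_inner_inverse_add_le ht hA hB hAA' hBB' hD x

end Sectorial

end LinearMap

/-! ### Transfer to matrices. -/

namespace Matrix

variable {n : ℕ} {α : ℝ} {A : Matrix (Fin n) (Fin n) ℂ}

theorem isSectorial_toEuclideanLin (hA : matrixNumericalRange A ⊆ sector α) :
    (toEuclideanLin A).IsSectorial (Real.tan α) := by
  intro x hx
  have hx' : 0 < ‖x‖ := norm_pos_iff.mpr hx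
  have hinner : ∀ y : EuclideanSpace ℂ (Fin n),
      inner ℂ y (toEuclideanLin A y) = star (y : Fin n → ℂ) ⬝ᵥ (A *ᵥ (y : Fin n → ℂ)) := by
    intro y
    rw [EuclideanSpace.inner_eq_star_dotProduct, dotProduct_comm]
    rfl
  set u : EuclideanSpace ℂ (Fin n) := ((‖x‖⁻¹ : ℝ) : ℂ) • x with hu
  have hun : ‖u‖ = 1 := by
    rw [hu, norm_smul, Complex.norm_real, Real.norm_of_nonneg (by positivity),
      inv_mul_cancel₀ hx'.ne']
  have hmem : inner ℂ u (toEuclideanLin A u) ∈ sector α := by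
    refine hA ⟨u, ?_, hinner u⟩
    rw [dotProduct_comm, ← EuclideanSpace.inner_eq_star_dotProduct, inner_self_eq_norm_sq_to_K, hun]
    simp
  have hxu : inner ℂ u (toEuclideanLin A u) =
      ((‖x‖⁻¹ ^ 2 : ℝ) : ℂ) * inner ℂ x (toEuclideanLin A x) := by
    rw [hu, map_smul, inner_smul_left, inner_smul_right, Complex.conj_ofReal]
    push_cast
    ring
  have hc : 0 < ‖x‖⁻¹ ^ 2 := by positivity
  obtain ⟨h1, h2⟩ := hmem
  rw [hxu, Complex.re_ofReal_mul] at h1 h2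
  rw [Complex.im_ofReal_mul, abs_mul, abs_of_pos hc, mul_left_comm] at h2
  exact ⟨pos_of_mul_pos_right h1 hc.le, le_of_mul_le_mul_left h2 hc⟩

theorem toEuclideanLin_mul (A B : Matrix (Fin n) (Fin n) ℂ) :
    toEuclideanLin (A * B) = toEuclideanLin A * toEuclideanLin B := by
  ext x i
  simp [toLpLin_apply, mulVec_mulVec]

theorem toEuclideanLin_one : toEuclideanLin (1 : Matrix (Fin n) (Fin n) ℂ) = 1 := by
  ext x i
  simp

theorem isUnit_of_isSectorial {t : ℝ} (hA : (toEuclideanLin A).IsSectorial t) : IsUnit A := by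
  rw [← mulVec_injective_iff_isUnit]
  intro x y h
  have := hA.injective (a₁ := WithLp.toLp 2 x) (a₂ := WithLp.toLp 2 y) (by
    simpa [toLpLin_apply] using h)
  simpa using this

theorem toEuclideanLin_mul_inv (hA : IsUnit A) :
    toEuclideanLin A * toEuclideanLin A⁻¹ = 1 := by
  rw [← toEuclideanLin_mul, mul_nonsing_inv _ ((isUnit_iff_isUnit_det A).mp hA), toEuclideanLin_one]

end Matrix

theorem theorem2p1 (n : ℕ) (α : ℝ) (hα₀ : 0 ≤ α) (hα₁ : α < Real.pi / 2)
    (A B : Matrix (Fin n) (Fin n) ℂ)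
    (hA : matrixNumericalRange A ⊆ sector α) (hB : matrixNumericalRange B ⊆ sector α) :
    (IsUnit A ∧ IsUnit B ∧ IsUnit (A + B)) ∧
    ∀ k : ℕ, 1 ≤ k → k ≤ n →
      (∏ j ∈ Finset.range k, matrixSingularValue (A + B)⁻¹ j
        ≤ (1 / Real.cos α) ^ (4 * k) / 4 ^ k
          * (∏ j ∈ Finset.range k, matrixSingularValue (1 + A⁻¹) j)
          * (∏ j ∈ Finset.range k, matrixSingularValue (1 + B⁻¹) j)) ∧
      (∏ j ∈ Finset.range k, matrixSingularValue (1 + (A + B)⁻¹) j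
        ≤ (1 / Real.cos α) ^ (2 * k)
          * (∏ j ∈ Finset.range k,
              matrixSingularValue (1 + (((1 / Real.cos α) ^ 2 / 4 : ℝ) : ℂ) • A⁻¹) j)
          * (∏ j ∈ Finset.range k,
              matrixSingularValue (1 + (((1 / Real.cos α) ^ 2 / 4 : ℝ) : ℂ) • B⁻¹) j)) := by
  have ht : 0 ≤ Real.tan α := Real.tan_nonneg_of_nonneg_of_le_pi_div_two hα₀ hα₁.le
  have hcos : 0 < Real.cos α := Real.cos_pos_of_mem_Ioo ⟨by linarith [Real.pi_pos], hα₁⟩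
  have hsec1 : 1 ≤ 1 / Real.cos α := by
    rw [le_div_iff₀ hcos, one_mul]; exact Real.cos_le_one α
  have hsec : 1 + Real.tan α ^ 2 = (1 / Real.cos α) ^ 2 := by
    rw [one_div, inv_pow, ← Real.inv_one_add_tan_sq hcos.ne', inv_inv]
  have hsqrt : √(1 + Real.tan α ^ 2) = 1 / Real.cos α := by
    rw [hsec, Real.sqrt_sq (by positivity)]
  have hAs := Matrix.isSectorial_toEuclideanLin hA
  have hBs := Matrix.isSectorial_toEuclideanLin hB
  have hABs : (Matrix.toEuclideanLin (A + B)).IsSectorial (Real.tan α) := by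
    rw [map_add]; exact hAs.add hBs
  have hAu := Matrix.isUnit_of_isSectorial hAs
  have hBu := Matrix.isUnit_of_isSectorial hBs
  have hABu := Matrix.isUnit_of_isSectorial hABs
  have hD := Matrix.toEuclideanLin_mul_inv hABu
  rw [map_add] at hD
  have h0 : ∀ (M : Matrix (Fin n) (Fin n) ℂ) (k : ℕ),
      0 ≤ ∏ j ∈ Finset.range k, (1 + Matrix.toEuclideanLin M).singularValues j :=
    fun M k => Finset.prod_nonneg fun _ _ => LinearMap.singularValues_nonneg _ _
  refine ⟨⟨hAu, hBu, hABu⟩, fun k _ hk => ?_⟩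
  have hk' : k ≤ Module.finrank ℂ (EuclideanSpace ℂ (Fin n)) := by simpa using hk
  simp only [matrixSingularValue, map_add, map_smul, Matrix.toEuclideanLin_one]
  -- Since `sec α ≥ 1`, the exponents `3 * k` and `k` may be raised to `4 * k` and `2 * k`.
  constructor
  · refine (LinearMap.prod_singularValues_inverse_add_le ht hAs hBs
      (Matrix.toEuclideanLin_mul_inv hAu) (Matrix.toEuclideanLin_mul_inv hBu) hD hk').trans ?_
    rw [hsqrt]
    gcongr
    · exact h0 _ _
    · exact h0 _ _
    · norm_num
  · refine (LinearMap.prod_singularValues_one_add_inverse_add_le ht hAs hBs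
      (Matrix.toEuclideanLin_mul_inv hAu) (Matrix.toEuclideanLin_mul_inv hBu) hD hk').trans ?_
    rw [hsqrt, hsec, ← map_smul, ← map_smul]
    gcongr
    · exact h0 _ _
    · exact h0 _ _
    · omega
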